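/- Let $p$ be a prime, $q$ a power of $p$, $\omega=e^{2\pi i/p}$, $\operatorname{tr}$ the trace from $\mathbb F_q$ to $\mathbb F_p$, and $n\ge 0$. **Codes.** On $\mathbb C^q$ with basis $\{|x\rangle : x\in\mathbb F_q\}$ put $X(a)|x\rangle=|x+a\rangle$ and $Z(b)|x\rangle=\omega^{\operatorname{tr}(bx)}|x\rangle$. The Pauli group $\mathcal P_n$ consists of the operators $\omega^cX(a_1)Z(b_1)\otimes\cdots\otimes X(a_n)Z(b_n)$ on $\mathbb C^{q^n}$. The stabilizer of a subspace $Q\subseteq\mathbb C^{q^n}$ is the group of all elements of $\mathcal P_n$ that fix every vector of $Q$. $Q$ is an $\mathbb F_q$-linear $[[n,k]]_q$ stabilizer code if $\dim Q=q^k$, its stabilizer is abelian and contains no scalar other than $1$, $Q$ is the space of all vectors fixed by its stabilizer, and the image of the stabilizer in $\mathbb F_q^{2n}$ under $\omega^c\bigotimes_i X(a_i)Z(b_i)\mapsto(a|b)$ is an $\mathbb F_q$-subspace. A stabilizer matrix of $Q$ is then a matrix whose rows form an $\mathbb F_q$-basis of this subspace. **Symplectic matroids.** Let $J=[n]\cup[n]^*$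 with the involution $i\leftrightarrow i^*$. A subset $S\subseteq J$ is admissible if $S\cap S^*=\emptyset$; a permutation of $J$ is admissible if it commutes with $*$. Order $J$ by $n>\cdots>1>1^*>\cdots>n^*$; for an admissible permutation $w$ let $i\le^w j$ mean $w^{-1}i\le w^{-1}j$, and for sets $A=\{a_1<^w\cdots<^wa_m\}$, $B=\{b_1<^w\cdots<^wb_m\}$ let $A\le^wB$ mean $a_i\le^wb_i$ for all $i$. A symplectic matroid of rank $r$ is a collection $\mathcal B$ (the bases) of admissible $r$-subsets of $J$ such that for every admissible $w$ there is a unique $B\in\mathcal B$ with $A\le^wB$ for all $A\in\mathcal B$. It is Lagrangian if $r=n$. A matrix $M\in\mathbb F_q^{r\times 2n}$ with columns indexed by $J$ is a representation of it over $\mathbb F_q$ if the row space of $M$ is isotropic for the form $\langle(a|b),(c|d)\rangle=a\cdot d-c\cdot b$ and $\mathcal B$ is the set of admissible $r$-subsets $B$ of $J$ such that the $r\times r$ minor of $M$ with columns $B$ is nonzero. A code $Q$ induces a symplectic matroid if $Q$ has a stabilizer matrix and every stabilizer matrix of $Q$ is a representation of the matroid. **Graph states.** Let $G$ be a simple graph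 on $[n]$ whose edges $uv$ carry weights $w_{uv}\in\mathbb F_q$. Let $S$ be the group generated by the operators $K_v(a)=X_v(a)\prod_{u\in N(v)}Z_u(a\,w_{uv})$, $v\in[n]$, $a\in\mathbb F_q$. The graph state of $(G,w)$ is the space of all vectors of $\mathbb C^{q^n}$ fixed by $S$. **Corollary.** For every weighted graph $(G,w)$ as above, the graph state is an $\mathbb F_q$-linear $[[n,0]]_q$ stabilizer code with stabilizer $S$, and it induces a symplectic matroid that is representable over $\mathbb F_q$ and Lagrangian, i.e. of maximal rank $n$. -/

import Mathlib

open scoped Matrix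

namespace QuantumMatroid

/-! ### Symplectic matroids -/

/-- The ground set `J = [n] ∪ [n]*`: the element `i` is `Sum.inl i`, the element `i*` is
`Sum.inr i`. -/
abbrev J (n : ℕ) : Type := Fin n ⊕ Fin n

/-- The involution `i ↦ i*`, `i* ↦ i` on `J`. -/
def starJ {n : ℕ} : J n → J n := Sum.swap

/-- A subset `S` of `J` is admissible if `S ∩ S* = ∅`. -/
def Admissible {n : ℕ} (S : Finset (J n)) : Prop := Disjoint S (S.image starJ)

/-- The position of an element in the base ordering
`n > n-1 > ⋯ > 2 > 1 > 1* > 2* > ⋯ > n*` of `J`: `i` has position `i`, and `i*` has position `-i`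
(indices counted from `1`). -/
def position {n : ℕ} : J n → ℤ
  | Sum.inl i => (i : ℤ) + 1
  | Sum.inr i => -((i : ℤ) + 1)

/-- Admissible permutations of `J`: those which commute with the involution. -/
def AdmissiblePerm {n : ℕ} (w : Equiv.Perm (J n)) : Prop := ∀ j, w (starJ j) = starJ (w j)

/-- `i ≤^w j` if and only if `w⁻¹ i ≤ w⁻¹ j` in the base ordering. -/
def ordLE {n : ℕ} (w : Equiv.Perm (J n)) (i j : J n) : Prop :=
  position (w⁻¹ i) ≤ position (w⁻¹ j)

/-- The strict version of `ordLE`. -/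
def ordLT {n : ℕ} (w : Equiv.Perm (J n)) (i j : J n) : Prop :=
  position (w⁻¹ i) < position (w⁻¹ j)

/-- `A ≤^w B` for two subsets of the same size `m`: if `a_1 <^w ⋯ <^w a_m` and `b_1 <^w ⋯ <^w b_m`
are their increasing enumerations, then `a_i ≤^w b_i` for all `i`. -/
def setLE {n : ℕ} (w : Equiv.Perm (J n)) (A B : Finset (J n)) : Prop :=
  ∃ (m : ℕ) (a b : Fin m → J n),
    (∀ i j, i < j → ordLT w (a i) (a j)) ∧ (∀ i j, i < j → ordLT w (b i) (b j)) ∧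
    Finset.univ.image a = A ∧ Finset.univ.image b = B ∧ ∀ i, ordLE w (a i) (b i)

/-- A symplectic matroid `(J, *, 𝓑)` of rank `rank` on `J = [n] ∪ [n]*`: a collection `𝓑` of
admissible `rank`-subsets of `J` with the maximality condition. -/
structure SymplecticMatroid (n : ℕ) where
  rank : ℕ
  bases : Set (Finset (J n))
  admissible : ∀ B ∈ bases, Admissible B
  card_eq : ∀ B ∈ bases, B.card = rank
  maximality : ∀ w : Equiv.Perm (J n), AdmissiblePerm w →
    ∃! B, B ∈ bases ∧ ∀ A ∈ bases, setLE w A B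

/-- A Lagrangian matroid is a symplectic matroid whose rank is the maximal possible value `n`. -/
def SymplecticMatroid.IsLagrangian {n : ℕ} (L : SymplecticMatroid n) : Prop := L.rank = n

/-! ### Representations -/

section Representations

variable {F : Type*} [Field F]

/-- The symplectic form `⟨(a|b), (c|d)⟩ = a · d - c · b` on `F^{2n}`. -/
def symplecticForm {n : ℕ} (u v : J n → F) : F :=
  (fun i => u (Sum.inl i)) ⬝ᵥ (fun i => v (Sum.inr i)) -
    (fun i => v (Sum.inl i)) ⬝ᵥ (fun i => u (Sum.inr i))

/-- Isotropic subspaces of `F^{2n}`. -/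
def IsIsotropic {n : ℕ} (U : Submodule F (J n → F)) : Prop :=
  ∀ u ∈ U, ∀ v ∈ U, symplecticForm u v = 0

/-- The row space of a matrix. -/
def rowSpace {n r : ℕ} (M : Matrix (Fin r) (J n) F) : Submodule F (J n → F) :=
  Submodule.span F (Set.range M.row)

/-- The bases of an `r × 2n` matrix `M`, with columns indexed by `J`: the admissible `r`-subsets
`B` of `J` such that the `r × r` minor of `M` with columns `B` is nonzero. (A nonzero minor forces
the enumeration `e` of `B` to be injective, so that `B` has `r` elements.) -/
def matrixBases {n r : ℕ} (M : Matrix (Fin r) (J n) F) : Set (Finset (J n)) :=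
  {B | Admissible B ∧ ∃ e : Fin r → J n, Finset.univ.image e = B ∧ (M.submatrix id e).det ≠ 0}

/-- The matrix `M` is a representation of the symplectic matroid `L`: its row space is isotropic
and the bases of `L` are those of `M`. -/
def SymplecticMatroid.IsRepresentedBy {n r : ℕ} (L : SymplecticMatroid n)
    (M : Matrix (Fin r) (J n) F) : Prop :=
  IsIsotropic (rowSpace M) ∧ L.bases = matrixBases M

variable (F) in
/-- `L` is representable over the field `F`. -/
def SymplecticMatroid.IsRepresentable {n : ℕ} (L : SymplecticMatroid n) : Prop :=
  ∃ (r : ℕ) (M : Matrix (Fin r) (J n) F), L.IsRepresentedBy M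

end Representations

/-! ### The Pauli group on `n` systems of level `q = |F|`, `F` a finite field of characteristic `p`

The space of `n` such systems is `ℂ^{q^n}`, with the basis `|x_1 ⋯ x_n⟩`, `x ∈ F^n`. Its vectors are
functions `(Fin n → F) → ℂ`, and operators are matrices. -/

section Pauli

variable (p : ℕ) [Fact p.Prime] {F : Type*} [Field F] [Fintype F] [DecidableEq F]
  [Algebra (ZMod p) F] {n : ℕ}

/-- `ω^c` for `c ∈ ℤ/p`, where `ω = exp(2πi/p)`. -/
noncomputable def omegaPow (c : ZMod p) : ℂ := ZMod.stdAddChar c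

/-- `X(a)|x⟩ = |x + a⟩`. -/
def opX (a : F) : Matrix F F ℂ := Matrix.of fun y x => if y = x + a then 1 else 0

/-- `Z(b)|x⟩ = ω^{tr(bx)}|x⟩`, with the trace from `F` to its prime field. -/
noncomputable def opZ (b : F) : Matrix F F ℂ :=
  Matrix.diagonal fun x => omegaPow p (Algebra.trace (ZMod p) F (b * x))

/-- The tensor product `M_1 ⊗ ⋯ ⊗ M_n` of operators on the single systems. -/
def tensorOp {D : Type*} (M : Fin n → Matrix D D ℂ) : Matrix (Fin n → D) (Fin n → D) ℂ :=
  Matrix.of fun y x => ∏ i, M i (y i) (x i)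

/-- `ω^c X(a_1)Z(b_1) ⊗ ⋯ ⊗ X(a_n)Z(b_n)`. -/
noncomputable def pauliOp (c : ZMod p) (a b : Fin n → F) : Matrix (Fin n → F) (Fin n → F) ℂ :=
  omegaPow p c • tensorOp fun i => opX (a i) * opZ p (b i)

theorem omegaPow_add (c d : ZMod p) : omegaPow p (c + d) = omegaPow p c * omegaPow p d :=
  AddChar.map_add_eq_mul _ c d

theorem omegaPow_zero : omegaPow p 0 = 1 := AddChar.map_zero_eq_one _

theorem omegaPow_sum (f : Fin n → ZMod p) : omegaPow p (∑ i, f i) = ∏ i, omegaPow p (f i) :=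
  map_prod (ZMod.stdAddChar (N := p)).toMonoidHom (fun i => Multiplicative.ofAdd (f i)) _

theorem opXZ_apply (a b y x : F) : (opX a * opZ p b) y x =
    if y = x + a then omegaPow p (Algebra.trace (ZMod p) F (b * x)) else 0 := by
  simp [opX, opZ, Matrix.mul_diagonal]

theorem opXZ_mul (a b a' b' : F) : (opX a * opZ p b) * (opX a' * opZ p b') =
    omegaPow p (Algebra.trace (ZMod p) F (b * a')) • (opX (a + a') * opZ p (b + b')) := by
  ext y x
  rw [Matrix.mul_apply, Matrix.smul_apply, opXZ_apply, Finset.sum_eq_single (x + a')]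
  · rw [opXZ_apply, opXZ_apply, if_pos rfl]
    have h : x + a' + a = x + (a + a') := by ring
    rw [h]
    split_ifs
    · rw [smul_eq_mul, ← omegaPow_add, ← omegaPow_add, ← map_add, ← map_add]
      congr 2
      ring
    · simp
  · intro z _ hz
    rw [opXZ_apply p a' b', if_neg hz, mul_zero]
  · simp

theorem tensorOp_mul {D : Type*} [Fintype D] (M N : Fin n → Matrix D D ℂ) :
    tensorOp M * tensorOp N = tensorOp fun i => M i * N i := by
  ext y x
  simp only [tensorOp, Matrix.mul_apply, Matrix.of_apply, ← Finset.prod_mul_distrib]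
  rw [Fintype.prod_sum]

theorem pauliOp_mul (c c' : ZMod p) (a b a' b' : Fin n → F) :
    pauliOp p c a b * pauliOp p c' a' b' =
      pauliOp p (c + c' + ∑ i, Algebra.trace (ZMod p) F (b i * a' i)) (a + a') (b + b') := by
  simp only [pauliOp, smul_mul_smul_comm, tensorOp_mul, opXZ_mul, omegaPow_add, omegaPow_sum]
  rw [mul_smul _ (∏ i, _)]
  congr 1
  ext y x
  simp [tensorOp, Finset.prod_mul_distrib]

theorem pauliOp_zero : pauliOp p 0 (0 : Fin n → F) 0 = 1 := by
  ext y x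
  simp only [pauliOp, omegaPow_zero, one_smul, tensorOp, Matrix.of_apply, opXZ_apply,
    Pi.zero_apply, zero_mul, map_zero, add_zero, Matrix.one_apply, funext_iff]
  by_cases h : ∀ i, y i = x i
  · simp [h]
  · rw [if_neg h]
    obtain ⟨i, hi⟩ := not_forall.mp h
    exact Finset.prod_eq_zero (Finset.mem_univ i) (if_neg hi)

/-- `pauliOp p c a b` as an invertible operator. -/
noncomputable def pauli (c : ZMod p) (a b : Fin n → F) : (Matrix (Fin n → F) (Fin n → F) ℂ)ˣ where
  val := pauliOp p c a b
  inv := pauliOp p (-c + ∑ i, Algebra.trace (ZMod p) F (b i * a i)) (-a) (-b)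
  val_inv := by
    rw [pauliOp_mul, ← pauliOp_zero p]
    congr 1 <;> simp
  inv_val := by
    rw [pauliOp_mul, ← pauliOp_zero p]
    congr 1 <;> simp

variable (F n) in
/-- The generalized Pauli group `𝒫_n = {ω^c X(a_1)Z(b_1) ⊗ ⋯ ⊗ X(a_n)Z(b_n)}`. -/
noncomputable def pauliGroup : Subgroup (Matrix (Fin n → F) (Fin n → F) ℂ)ˣ where
  carrier := {g | ∃ c a b, g = pauli p c a b}
  one_mem' := ⟨0, 0, 0, Units.ext (pauliOp_zero p).symm⟩
  mul_mem' := by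
    rintro _ _ ⟨c, a, b, rfl⟩ ⟨c', a', b', rfl⟩
    exact ⟨_, _, _, Units.ext (pauliOp_mul p c c' a b a' b')⟩
  inv_mem' := by
    rintro _ ⟨c, a, b, rfl⟩
    exact ⟨_, _, _, Units.ext rfl⟩

/-! ### Stabilizer codes -/

/-- The vectors fixed by all the elements of a group `S` of operators (the joint eigenspace of `S`
with eigenvalue `1`). -/
def fixedSpace (S : Subgroup (Matrix (Fin n → F) (Fin n → F) ℂ)ˣ) :
    Submodule ℂ ((Fin n → F) → ℂ) where
  carrier := {ψ | ∀ g ∈ S, g.val *ᵥ ψ = ψ}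
  zero_mem' := fun g _ => Matrix.mulVec_zero g.val
  add_mem' := fun hφ hψ g hg => by rw [Matrix.mulVec_add, hφ g hg, hψ g hg]
  smul_mem' := fun c ψ hψ g hg => by rw [Matrix.mulVec_smul, hψ g hg]

/-- The stabilizer of a code `Q`: the elements of the Pauli group which fix every vector of `Q`. -/
noncomputable def codeStabilizer (Q : Submodule ℂ ((Fin n → F) → ℂ)) :
    Subgroup (Matrix (Fin n → F) (Fin n → F) ℂ)ˣ where
  carrier := {g | g ∈ pauliGroup p F n ∧ ∀ ψ ∈ Q, g.val *ᵥ ψ = ψ}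
  one_mem' := ⟨one_mem _, fun ψ _ => by simp⟩
  mul_mem' := fun {g h} hg hh => ⟨mul_mem hg.1 hh.1, fun ψ hψ => by
    rw [Units.val_mul, ← Matrix.mulVec_mulVec, hh.2 ψ hψ, hg.2 ψ hψ]⟩
  inv_mem' := fun {g} hg => ⟨inv_mem hg.1, fun ψ hψ => by
    conv_lhs => rw [← hg.2 ψ hψ]
    rw [Matrix.mulVec_mulVec, Units.inv_mul, Matrix.one_mulVec]⟩

/-- The image in `F^{2n}` of a group `S` of Pauli operators under
`ω^c X(a_1)Z(b_1) ⊗ ⋯ ⊗ X(a_n)Z(b_n) ↦ (a|b)`. -/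
def symplecticImage (S : Subgroup (Matrix (Fin n → F) (Fin n → F) ℂ)ˣ) : Set (J n → F) :=
  {u | ∃ c a b, pauli p c a b ∈ S ∧ u = Sum.elim a b}

/-- `Q` is an `F`-linear `[[n,k]]_q` stabilizer code, `q = |F|`: a `q^k`-dimensional subspace of
`ℂ^{q^n}`, the joint eigenspace of its stabilizer, which is an abelian subgroup of the Pauli group
without nontrivial scalars, and whose image in `F^{2n}` is an `F`-linear subspace. -/
structure IsLinearStabilizerCode (k : ℕ) (Q : Submodule ℂ ((Fin n → F) → ℂ)) : Prop where
  dim : Module.finrank ℂ Q = Fintype.card F ^ k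
  eigenspace : fixedSpace (codeStabilizer p Q) = Q
  abelian : ∀ g ∈ codeStabilizer p Q, ∀ h ∈ codeStabilizer p Q, g * h = h * g
  scalar : ∀ g ∈ codeStabilizer p Q, ∀ z : ℂ, g.val = z • 1 → g = 1
  linear : ∃ U : Submodule F (J n → F), (U : Set (J n → F)) = symplecticImage p (codeStabilizer p Q)

/-- `M` is a stabilizer matrix of the code `Q`: its rows form an `F`-basis of the image of the
stabilizer of `Q` in `F^{2n}`. -/
def IsStabilizerMatrix {r : ℕ} (Q : Submodule ℂ ((Fin n → F) → ℂ))
    (M : Matrix (Fin r) (J n) F) : Prop :=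
  LinearIndependent F M.row ∧
    (rowSpace M : Set (J n → F)) = symplecticImage p (codeStabilizer p Q)

/-- The code `Q` induces the symplectic matroid `L`: the code has a stabilizer matrix, and every
stabilizer matrix of the code is a representation of `L`. -/
def Induces (Q : Submodule ℂ ((Fin n → F) → ℂ)) (L : SymplecticMatroid n) : Prop :=
  (∃ (r : ℕ) (M : Matrix (Fin r) (J n) F), IsStabilizerMatrix p Q M) ∧
    ∀ (r : ℕ) (M : Matrix (Fin r) (J n) F), IsStabilizerMatrix p Q M → L.IsRepresentedBy M

/-! ### Graph states -/

/-- `K_v(a) = X_v(a) ∏_{u ∈ N(v)} Z_u(a w_{uv})` for a vertex `v` of the graph `G` on `[n]` with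
edge weights `w` (a vertex is not its own neighbour). -/
noncomputable def graphGenerator (G : SimpleGraph (Fin n)) [DecidableRel G.Adj]
    (w : Sym2 (Fin n) → F) (v : Fin n) (a : F) : (Matrix (Fin n → F) (Fin n → F) ℂ)ˣ :=
  pauli p 0 (Pi.single v a) (fun u => if G.Adj v u then a * w s(u, v) else 0)

/-- The stabilizer group of the weighted graph, generated by all `K_v(a)`, `v ∈ V(G)`, `a ∈ F`.
For prime `q` the operators `K_v(1)` suffice, as `K_v(a)` is then a power of `K_v(1)`; for other `q`
the multiples `a` are what makes the stabilizer `F`-linear. -/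
noncomputable def graphStabilizer (G : SimpleGraph (Fin n)) [DecidableRel G.Adj]
    (w : Sym2 (Fin n) → F) : Subgroup (Matrix (Fin n → F) (Fin n → F) ℂ)ˣ :=
  Subgroup.closure {g | ∃ v a, g = graphGenerator p G w v a}

/-- The graph state, as a subspace of `ℂ^{q^n}`: the joint eigenspace of the stabilizer group of the
weighted graph. -/
noncomputable def graphState (G : SimpleGraph (Fin n)) [DecidableRel G.Adj]
    (w : Sym2 (Fin n) → F) : Submodule ℂ ((Fin n → F) → ℂ) :=
  fixedSpace (graphStabilizer p G w)

end Pauli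

end QuantumMatroid

namespace QuantumMatroid

/-! ### The symplectic matroid of an isotropic subspace -/

/-! Two independent facts combine. An isotropic subspace `U` gives a symplectic matroid, whose bases
are the admissible sets of size `dim U` onto which `U` projects injectively. For an admissible `w`
the maximal basis is `pivots w U`, the set of leading positions of vectors of `U`. It is admissible
because vectors leading at `k` and `k*` would pair to a nonzero value (`admissible_pivots`), and it
dominates every basis by a dimension count below each threshold (`card_pivots_filter_le`). Any
matrix with independent rows and row space `U` represents this matroid. For the graph state, let `Γ`
be the weighted adjacency matrix and `φ` the quadratic form `graphPhase`. The polarization of `φ` is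
`tr (Γa · a')`, so `a ↦ ω^{φ(a)} X(a)Z(Γa)` is a homomorphism, and its image is `S`. A vector fixed
by `S` is determined by its value at `0`, so the graph state is the line through `x ↦ ω^{φ(x)}`.
Nondegeneracy of the trace shows that only elements of `S` fix that vector among Pauli operators.
The image of the stabilizer is therefore `{(a | Γa)}`, which is isotropic as `Γ` is symmetric, and
has dimension `n`. -/

theorem position_starJ {n : ℕ} (j : J n) : position (starJ j) = -position j := by
  cases j <;> simp [position, starJ]

theorem position_injective {n : ℕ} : Function.Injective (position (n := n)) := by
  rintro (i | i) (j | j) h <;> simp only [position] at h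
  · exact congrArg _ (Fin.ext (by omega))
  · omega
  · omega
  · exact congrArg _ (Fin.ext (by omega))

/-- The position of an element of `J` in the ordering `≤^w`. -/
def wPosition {n : ℕ} (w : Equiv.Perm (J n)) (j : J n) : ℤ := position (w⁻¹ j)

theorem wPosition_injective {n : ℕ} (w : Equiv.Perm (J n)) : Function.Injective (wPosition w) :=
  position_injective.comp (w⁻¹).injective

theorem wPosition_starJ {n : ℕ} {w : Equiv.Perm (J n)} (hw : AdmissiblePerm w) (j : J n) :
    wPosition w (starJ j) = -wPosition w j := by
  have h : w⁻¹ (starJ j) = starJ (w⁻¹ j) := by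
    rw [Equiv.Perm.inv_eq_iff_eq, hw]
    simp
  rw [wPosition, h, position_starJ, wPosition]

/-! ### The order `≤^w` on sets: a counting criterion and antisymmetry. -/

theorem exists_increasing_enumeration {n m : ℕ} (w : Equiv.Perm (J n)) (A : Finset (J n))
    (hA : A.card = m) :
    ∃ a : Fin m → J n, (∀ i j, i < j → wPosition w (a i) < wPosition w (a j)) ∧
      Finset.univ.image a = A := by
  let φ : J n ↪ ℤ := ⟨wPosition w, wPosition_injective w⟩
  have hc : (A.map φ).card = m := by rw [Finset.card_map, hA]
  have hmem : ∀ i, ∃ x ∈ A, φ x = (A.map φ).orderEmbOfFin hc i := fun i =>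
    Finset.mem_map.mp (Finset.orderEmbOfFin_mem _ hc i)
  choose a ha hφ using hmem
  have hlt : ∀ i j, i < j → φ (a i) < φ (a j) := fun i j hij => by
    rw [hφ, hφ]
    exact (OrderEmbedding.lt_iff_lt _).mpr hij
  have hinj : Function.Injective a := fun i j h => by
    rcases lt_trichotomy i j with h' | h' | h'
    · exact absurd (hlt _ _ h') (by rw [h]; exact lt_irrefl _)
    · exact h'
    · exact absurd (hlt _ _ h') (by rw [h]; exact lt_irrefl _)
  refine ⟨a, hlt, Finset.eq_of_subset_of_card_le ?_ ?_⟩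
  · simpa [Finset.image_subset_iff] using ha
  · rw [Finset.card_image_of_injective _ hinj, hA]
    simp

/-- If `b i` were below `a i`, then below the threshold `a i` the set `B` would have at least `i +
1` elements and `A` at most `i` (indices from `0`). -/
theorem setLE_of_card_filter_le {n m : ℕ} (w : Equiv.Perm (J n)) {A B : Finset (J n)}
    (hA : A.card = m) (hB : B.card = m)
    (h : ∀ t : ℤ, (B.filter (wPosition w · < t)).card ≤ (A.filter (wPosition w · < t)).card) :
    setLE w A B := by
  obtain ⟨a, ha, hA'⟩ := exists_increasing_enumeration w A hA
  obtain ⟨b, hb, hB'⟩ := exists_increasing_enumeration w B hB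
  refine ⟨m, a, b, ha, hb, hA', hB', fun i => ?_⟩
  by_contra hi
  have hi : wPosition w (b i) < wPosition w (a i) := not_le.mp hi
  have hbm : StrictMono (wPosition w ∘ b) := fun i j => hb i j
  have ham : StrictMono (wPosition w ∘ a) := fun i j => ha i j
  have h1 : (Finset.Iic i).image b ⊆ B.filter (wPosition w · < wPosition w (a i)) := by
    intro x hx
    obtain ⟨k, hk, rfl⟩ := Finset.mem_image.mp hx
    refine Finset.mem_filter.mpr ⟨hB' ▸ Finset.mem_image_of_mem _ (Finset.mem_univ _), ?_⟩
    exact (hbm.monotone (Finset.mem_Iic.mp hk)).trans_lt hi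
  have h2 : A.filter (wPosition w · < wPosition w (a i)) ⊆ (Finset.Iio i).image a := by
    intro x hx
    obtain ⟨hxA, hx⟩ := Finset.mem_filter.mp hx
    rw [← hA'] at hxA
    obtain ⟨k, -, rfl⟩ := Finset.mem_image.mp hxA
    exact Finset.mem_image_of_mem _ (Finset.mem_Iio.mpr (ham.lt_iff_lt.mp hx))
  have h3 := (Finset.card_le_card h1).trans ((h _).trans (Finset.card_le_card h2))
  rw [Finset.card_image_of_injective _ hbm.injective.of_comp] at h3
  have h4 := h3.trans Finset.card_image_le
  simp at h4

theorem setLE.exists_enumeration {n : ℕ} {w : Equiv.Perm (J n)} {A B : Finset (J n)}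
    (h : setLE w A B) : ∃ (m : ℕ) (a b : Fin m → J n), Finset.univ.image a = A ∧
      Finset.univ.image b = B ∧ (∀ i, wPosition w (a i) ≤ wPosition w (b i)) ∧
      ∑ x ∈ A, wPosition w x = ∑ i, wPosition w (a i) ∧
      ∑ x ∈ B, wPosition w x = ∑ i, wPosition w (b i) := by
  obtain ⟨m, a, b, ha, hb, rfl, rfl, hab⟩ := h
  have ham : StrictMono (wPosition w ∘ a) := fun i j => ha i j
  have hbm : StrictMono (wPosition w ∘ b) := fun i j => hb i j
  exact ⟨m, a, b, rfl, rfl, hab, Finset.sum_image fun x _ y _ h => ham.injective.of_comp h,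
    Finset.sum_image fun x _ y _ h => hbm.injective.of_comp h⟩

theorem setLE.sum_le {n : ℕ} {w : Equiv.Perm (J n)} {A B : Finset (J n)} (h : setLE w A B) :
    ∑ x ∈ A, wPosition w x ≤ ∑ x ∈ B, wPosition w x := by
  obtain ⟨m, a, b, -, -, hab, hA, hB⟩ := h.exists_enumeration
  rw [hA, hB]
  exact Finset.sum_le_sum fun i _ => hab i

/-- Both inequalities force equal sums of positions, so each termwise inequality of one enumeration
is an equality. -/
theorem setLE.antisymm {n : ℕ} {w : Equiv.Perm (J n)} {A B : Finset (J n)} (h : setLE w A B)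
    (h' : setLE w B A) : A = B := by
  have hle := h'.sum_le
  obtain ⟨m, a, b, rfl, rfl, hab, hA, hB⟩ := h.exists_enumeration
  rw [hA, hB] at hle
  have heq := (Finset.sum_eq_sum_iff_of_le fun i _ => hab i).mp
    (le_antisymm (Finset.sum_le_sum fun i _ => hab i) hle)
  congr 1
  exact funext fun i => wPosition_injective w (heq i (Finset.mem_univ i))

/-! ### Leading positions in an isotropic subspace. -/

section Isotropic

variable {F : Type*} [Field F] {n : ℕ}

/-- The admissible subsets `B` of `J` of size `dim U` such that the projection `U → F^B` is
injective. -/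
def subspaceBases (U : Submodule F (J n → F)) : Set (Finset (J n)) :=
  {B | Admissible B ∧ B.card = Module.finrank F U ∧ ∀ u ∈ U, (∀ j ∈ B, u j = 0) → u = 0}

open Classical in
/-- The positions of the leading coordinates of the vectors of `U` in the ordering `≤^w`. -/
noncomputable def pivots (w : Equiv.Perm (J n)) (U : Submodule F (J n → F)) : Finset (J n) :=
  {j | ∃ u ∈ U, u j ≠ 0 ∧ ∀ k, wPosition w j < wPosition w k → u k = 0}

theorem mem_pivots {w : Equiv.Perm (J n)} {U : Submodule F (J n → F)} {j : J n} :
    j ∈ pivots w U ↔ ∃ u ∈ U, u j ≠ 0 ∧ ∀ k, wPosition w j < wPosition w k → u k = 0 := by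
  simp [pivots]

theorem eq_zero_of_pivots (w : Equiv.Perm (J n)) {U : Submodule F (J n → F)} {u : J n → F}
    (hu : u ∈ U) (h : ∀ j ∈ pivots w U, u j = 0) : u = 0 := by
  classical
  by_contra hne
  obtain ⟨j₀, hj₀⟩ := Function.ne_iff.mp hne
  obtain ⟨j, hj, hmax⟩ := Finset.exists_max_image (Finset.univ.filter fun j => u j ≠ 0)
    (wPosition w) ⟨j₀, by simpa using hj₀⟩
  refine (Finset.mem_filter.mp hj).2 (h j (mem_pivots.mpr ⟨u, hu, (Finset.mem_filter.mp hj).2,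
    fun k hk => ?_⟩))
  by_contra hk'
  exact absurd (hmax k (by simpa using hk')) (not_le.mpr hk)

theorem admissible_pivots {w : Equiv.Perm (J n)} (hw : AdmissiblePerm w)
    {U : Submodule F (J n → F)} (hU : IsIsotropic U) : Admissible (pivots w U) := by
  refine Finset.disjoint_left.mpr fun j hj hj' => ?_
  obtain ⟨k, hk, rfl⟩ := Finset.mem_image.mp hj'
  obtain ⟨u, hu, hu0, hu1⟩ := mem_pivots.mp hk
  obtain ⟨v, hv, hv0, hv1⟩ := mem_pivots.mp hj
  -- The involution negates `w`-positions: for `l` above `k` the leading condition kills `u l`, and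
  -- for `l` below `k` the element `l*` is above `k*`, where `v` vanishes.
  have hz : ∀ l, l ≠ k → u l * v (starJ l) = 0 := by
    intro l hl
    rcases lt_trichotomy (wPosition w k) (wPosition w l) with h | h | h
    · rw [hu1 l h, zero_mul]
    · exact absurd (wPosition_injective w h).symm hl
    · rw [hv1 (starJ l) (by rw [wPosition_starJ hw, wPosition_starJ hw]; omega), mul_zero]
  have h0 := hU u hu v hv
  rw [symplecticForm, dotProduct, dotProduct, ← Finset.sum_sub_distrib] at h0
  -- Only the term `± u k * v k*` of the form survives; its sign depends on the half of `J`
  -- containing `k`.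
  refine mul_ne_zero hu0 hv0 ?_
  rcases k with i | i
  · rw [Finset.sum_eq_single i] at h0
    · rw [mul_comm (v _), show v (Sum.inl i) = v (starJ (Sum.inr i)) from rfl,
        hz (Sum.inr i) (by simp), sub_zero] at h0
      exact h0
    · intro l _ hl
      have h1 := hz (Sum.inl l) (by simpa using hl)
      have h2 := hz (Sum.inr l) (by simp)
      simp only [starJ, Sum.swap_inl, Sum.swap_inr] at h1 h2
      rw [h1, mul_comm, h2, sub_zero]
    · simp
  · rw [Finset.sum_eq_single i] at h0
    · rw [mul_comm (v _), show v (Sum.inr i) = v (starJ (Sum.inl i)) from rfl,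
        hz (Sum.inl i) (by simp), zero_sub, neg_eq_zero] at h0
      exact h0
    · intro l _ hl
      have h1 := hz (Sum.inl l) (by simp)
      have h2 := hz (Sum.inr l) (by simpa using hl)
      simp only [starJ, Sum.swap_inl, Sum.swap_inr] at h1 h2
      rw [h1, mul_comm, h2, sub_zero]
    · simp

/-- In a vanishing combination, consider the highest index with nonzero coefficient: at that
coordinate no other vector contributes. -/
theorem linearIndependent_of_leading (w : Equiv.Perm (J n)) {s : Finset (J n)}
    (u : s → J n → F) (h0 : ∀ j, u j j ≠ 0)
    (h1 : ∀ (j : s) (k : J n), wPosition w j < wPosition w k → u j k = 0) :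
    LinearIndependent F u := by
  classical
  rw [Fintype.linearIndependent_iff]
  intro c hc
  by_contra! hne
  obtain ⟨j₀, hj₀⟩ := hne
  obtain ⟨j, hj, hmax⟩ := Finset.exists_max_image (Finset.univ.filter fun j => c j ≠ 0)
    (fun j : s => wPosition w j) ⟨j₀, by simpa using hj₀⟩
  have h := congrFun hc j
  rw [Finset.sum_apply, Finset.sum_eq_single j] at h
  · exact mul_ne_zero (Finset.mem_filter.mp hj).2 (h0 j) h
  · intro k _ hk
    by_cases hck : c k = 0
    · simp [hck]
    · have hle := hmax k (by simpa using hck)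
      have hlt := lt_of_le_of_ne hle fun h => hk (Subtype.ext (wPosition_injective w h))
      simp [h1 k j hlt]
  · simp

/-- If `U → F^A` is injective, then `A` has, below each position, at least as many elements as the
set of pivots. -/
theorem card_pivots_filter_le (w : Equiv.Perm (J n)) {U : Submodule F (J n → F)}
    {A : Finset (J n)} (hA : ∀ u ∈ U, (∀ j ∈ A, u j = 0) → u = 0) (t : ℤ) :
    ((pivots w U).filter (wPosition w · < t)).card ≤ (A.filter (wPosition w · < t)).card := by
  set s := (pivots w U).filter (wPosition w · < t) with hs
  have hex : ∀ j : s, ∃ u ∈ U, u j ≠ 0 ∧ ∀ k, wPosition w j < wPosition w k → u k = 0 :=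
    fun j => mem_pivots.mp (Finset.mem_filter.mp j.2).1
  choose u hu h0 h1 using hex
  have hli := linearIndependent_of_leading w u h0 h1
  -- `W` lies in `U`, is supported below `t`, and has one dimension per pivot below `t`. Hence `A`
  -- can detect it only through its elements below `t`.
  let W : Submodule F (J n → F) := Submodule.span F (Set.range u)
  have hW : ∀ v ∈ W, v ∈ U ∧ ∀ k, t ≤ wPosition w k → v k = 0 := by
    intro v hv
    induction hv using Submodule.span_induction with
    | mem x hx =>
      obtain ⟨j, rfl⟩ := hx
      exact ⟨hu j, fun k hk => h1 j k ((Finset.mem_filter.mp j.2).2.trans_le hk)⟩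
    | zero => exact ⟨zero_mem _, fun _ _ => rfl⟩
    | add x y _ _ hx hy =>
      exact ⟨add_mem hx.1 hy.1, fun k hk => by simp [hx.2 k hk, hy.2 k hk]⟩
    | smul c x _ hx => exact ⟨U.smul_mem c hx.1, fun k hk => by simp [hx.2 k hk]⟩
  let A' := A.filter (wPosition w · < t)
  let f : W →ₗ[F] (A' → F) := (LinearMap.funLeft F F (Subtype.val : A' → J n)).comp W.subtype
  have hf : Function.Injective f := by
    rw [injective_iff_map_eq_zero]
    rintro ⟨v, hv⟩ hfv
    refine Subtype.ext (hA v (hW v hv).1 fun j hj => ?_)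
    by_cases hjt : wPosition w j < t
    · exact congrFun hfv ⟨j, Finset.mem_filter.mpr ⟨hj, hjt⟩⟩
    · exact (hW v hv).2 j (not_lt.mp hjt)
  have hle := LinearMap.finrank_le_finrank_of_injective hf
  rw [finrank_span_eq_card hli] at hle
  simpa using hle

/-- Vectors with distinct leading positions are independent, and restriction of `U` to the pivots is
injective. -/
theorem card_pivots (w : Equiv.Perm (J n)) (U : Submodule F (J n → F)) :
    (pivots w U).card = Module.finrank F U := by
  have hex : ∀ j : pivots w U, ∃ u : U, (u : J n → F) j ≠ 0 ∧
      ∀ k, wPosition w j < wPosition w k → (u : J n → F) k = 0 := fun j => by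
    obtain ⟨u, hu, h⟩ := mem_pivots.mp j.2
    exact ⟨⟨u, hu⟩, h⟩
  choose u h0 h1 using hex
  have hli : LinearIndependent F u := LinearIndependent.of_comp U.subtype
    (linearIndependent_of_leading w (fun j => (u j : J n → F)) h0 h1)
  refine le_antisymm (by simpa using hli.fintype_card_le_finrank) ?_
  let f : U →ₗ[F] (pivots w U → F) :=
    (LinearMap.funLeft F F (Subtype.val : pivots w U → J n)).comp U.subtype
  have hf : Function.Injective f := by
    rw [injective_iff_map_eq_zero]
    rintro ⟨v, hv⟩ hfv
    exact Subtype.ext (eq_zero_of_pivots w hv fun j hj => congrFun hfv ⟨j, hj⟩)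
  simpa using LinearMap.finrank_le_finrank_of_injective hf

/-- The symplectic matroid of an isotropic subspace. -/
noncomputable def isotropicMatroid (U : Submodule F (J n → F)) (hU : IsIsotropic U) :
    SymplecticMatroid n where
  rank := Module.finrank F U
  bases := subspaceBases U
  admissible := fun _ hB => hB.1
  card_eq := fun _ hB => hB.2.1
  maximality := fun w hw => by
    have hP : pivots w U ∈ subspaceBases U :=
      ⟨admissible_pivots hw hU, card_pivots w U, fun u hu h => eq_zero_of_pivots w hu h⟩
    have hmax : ∀ A ∈ subspaceBases U, setLE w A (pivots w U) := fun A hA =>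
      setLE_of_card_filter_le w hA.2.1 (card_pivots w U) (card_pivots_filter_le w hA.2.2)
    exact ⟨pivots w U, ⟨hP, hmax⟩, fun B hB => (hmax B hB.1).antisymm (hB.2 _ hP)⟩

/-! ### Minors of a matrix in terms of its row space. -/

theorem mem_rowSpace_iff {r : ℕ} {M : Matrix (Fin r) (J n) F} {u : J n → F} :
    u ∈ rowSpace M ↔ ∃ v, v ᵥ* M = u := by
  rw [rowSpace, Submodule.mem_span_range_iff_exists_fun]
  simp_rw [Matrix.vecMul_eq_sum]
  rfl

/-- Independence of the rows identifies coefficient vectors `v` with row vectors `v ᵥ* M`, so the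
left kernel of the minor consists of the row vectors vanishing on the chosen columns. -/
theorem det_submatrix_ne_zero_iff {r : ℕ} {M : Matrix (Fin r) (J n) F}
    (hM : LinearIndependent F M.row) (e : Fin r → J n) :
    (M.submatrix id e).det ≠ 0 ↔ ∀ u ∈ rowSpace M, (∀ i, u (e i) = 0) → u = 0 := by
  have hcomp : ∀ v, v ᵥ* M.submatrix id e = fun i => (v ᵥ* M) (e i) := fun v => rfl
  rw [Ne, ← Matrix.exists_vecMul_eq_zero_iff]
  push Not
  constructor
  · intro h u hu hue
    obtain ⟨v, rfl⟩ := mem_rowSpace_iff.mp hu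
    by_contra hne
    exact h v (by rintro rfl; simp at hne) ((hcomp v).trans (funext hue))
  · intro h v hv h0
    have h1 := h (v ᵥ* M) (mem_rowSpace_iff.mpr ⟨v, rfl⟩) fun i => congrFun h0 i
    exact hv (Matrix.vecMul_injective_iff.mpr hM (h1.trans (Matrix.zero_vecMul M).symm))

theorem matrixBases_eq_subspaceBases {r : ℕ} {M : Matrix (Fin r) (J n) F}
    (hM : LinearIndependent F M.row) : matrixBases M = subspaceBases (rowSpace M) := by
  have hr : Module.finrank F (rowSpace M) = r := by
    rw [rowSpace, finrank_span_eq_card hM, Fintype.card_fin]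
  ext B
  refine and_congr_right fun _ => ?_
  rw [hr]
  constructor
  · rintro ⟨e, rfl, he⟩
    refine ⟨?_, fun u hu h => (det_submatrix_ne_zero_iff hM e).mp he u hu fun i =>
      h _ (Finset.mem_image_of_mem _ (Finset.mem_univ i))⟩
    have hinj : Function.Injective e := fun i j hij => by
      by_contra hne
      exact he (Matrix.det_zero_of_column_eq hne fun k => by simp [hij])
    rw [Finset.card_image_of_injective _ hinj]
    simp
  · rintro ⟨hc, h⟩
    let e := B.equivFinOfCardEq hc
    refine ⟨fun i => e.symm i, ?_, (det_submatrix_ne_zero_iff hM _).mpr fun u hu hue =>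
      h u hu fun j hj => by simpa using hue (e ⟨j, hj⟩)⟩
    ext j
    simp only [Finset.mem_image, Finset.mem_univ, true_and]
    exact ⟨by rintro ⟨i, rfl⟩; exact (e.symm i).2, fun hj => ⟨e ⟨j, hj⟩, by simp⟩⟩

theorem isotropicMatroid_isRepresentedBy {U : Submodule F (J n → F)} (hU : IsIsotropic U) {r : ℕ}
    {M : Matrix (Fin r) (J n) F} (hM : LinearIndependent F M.row) (hMU : rowSpace M = U) :
    (isotropicMatroid U hU).IsRepresentedBy M := by
  subst hMU
  exact ⟨hU, (matrixBases_eq_subspaceBases hM).symm⟩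

theorem exists_matrix_rowSpace_eq (U : Submodule F (J n → F)) :
    ∃ M : Matrix (Fin (Module.finrank F U)) (J n) F,
      LinearIndependent F M.row ∧ rowSpace M = U := by
  let b := Module.finBasis F U
  refine ⟨Matrix.of fun i => (b i : J n → F),
    b.linearIndependent.map' U.subtype (Submodule.ker_subtype U), ?_⟩
  have h := congrArg (Submodule.map U.subtype) b.span_eq
  rw [Submodule.map_span, Submodule.map_top, Submodule.range_subtype, ← Set.range_comp] at h
  exact h

end Isotropic

/-! ### Graph states -/

/-! ### The quadratic phase and its polarization. -/

section GraphPhase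

variable (p : ℕ) [Fact p.Prime]

theorem omegaPow_injective : Function.Injective (omegaPow p) := ZMod.injective_stdAddChar

theorem omegaPow_ne_zero (c : ZMod p) : omegaPow p c ≠ 0 := fun h => by
  have h1 := omegaPow_add p c (-c)
  rw [add_neg_cancel, omegaPow_zero, h, zero_mul] at h1
  exact one_ne_zero h1

section Trace

variable {F : Type*} [Field F] [Algebra (ZMod p) F] {n : ℕ}

/-- The quadratic form `tr (∑_{u < v} Γ_{uv} a_u a_v)`. -/
noncomputable def graphPhase (Γ : Matrix (Fin n) (Fin n) F) (a : Fin n → F) : ZMod p :=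
  Algebra.trace (ZMod p) F (∑ u, ∑ v, if u < v then Γ u v * a u * a v else 0)

theorem graphPhase_zero (Γ : Matrix (Fin n) (Fin n) F) : graphPhase p Γ 0 = 0 := by
  simp [graphPhase]

/-- Every monomial involves two distinct vertices. This is why the generators `K_v(a)` carry no
phase. -/
theorem graphPhase_single (Γ : Matrix (Fin n) (Fin n) F) (v : Fin n) (x : F) :
    graphPhase p Γ (Pi.single v x) = 0 := by
  rw [graphPhase, Finset.sum_eq_zero, map_zero]
  refine fun i _ => Finset.sum_eq_zero fun j _ => ?_
  split_ifs with hij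
  · by_cases hi : i = v
    · subst hi
      simp [hij.ne']
    · simp [hi]
  · rfl

/-- Polarization of the quadratic form. Counting each edge once, through `u < v`, avoids division by
2, so characteristic 2 is included. -/
theorem graphPhase_add {Γ : Matrix (Fin n) (Fin n) F} (hΓ : Γ.IsSymm) (hd : ∀ i, Γ i i = 0)
    (a a' : Fin n → F) : graphPhase p Γ (a + a') =
      graphPhase p Γ a + graphPhase p Γ a' + Algebra.trace (ZMod p) F (Γ *ᵥ a ⬝ᵥ a') := by
  have hbil : Γ *ᵥ a ⬝ᵥ a' = ∑ u, ∑ v, (if u < v then Γ u v * (a u * a' v + a' u * a v) else 0) := by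
    -- After exchanging `u` and `v` in the first summand, the two summands are the parts of the
    -- double sum below and above the diagonal.
    have h1 : ∀ u v, (if u < v then Γ u v * (a u * a' v + a' u * a v) else 0) =
        (if u < v then Γ v u * a u * a' v else 0) + (if u < v then Γ u v * a v * a' u else 0) := by
      intro u v
      split_ifs
      · rw [hΓ.apply u v]
        ring
      · simp
    simp_rw [h1, Finset.sum_add_distrib]
    rw [Finset.sum_comm, ← Finset.sum_add_distrib, dotProduct]
    refine Finset.sum_congr rfl fun u _ => ?_
    rw [Matrix.mulVec, dotProduct, Finset.sum_mul, ← Finset.sum_add_distrib]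
    refine Finset.sum_congr rfl fun v _ => ?_
    rcases lt_trichotomy u v with h | rfl | h
    · simp [h, h.not_gt]
    · simp [hd]
    · simp [h, h.not_gt]
  rw [graphPhase, graphPhase, graphPhase, ← map_add, ← map_add, hbil, ← Finset.sum_add_distrib,
    ← Finset.sum_add_distrib]
  congr 1
  refine Finset.sum_congr rfl fun u _ => ?_
  rw [← Finset.sum_add_distrib, ← Finset.sum_add_distrib]
  refine Finset.sum_congr rfl fun v _ => ?_
  split_ifs
  · simp only [Pi.add_apply]
    ring
  · simp

/-- The amplitudes `ω^{graphPhase x}` of the graph state. -/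
noncomputable def graphVector (Γ : Matrix (Fin n) (Fin n) F) (x : Fin n → F) : ℂ :=
  omegaPow p (graphPhase p Γ x)

theorem graphVector_ne_zero (Γ : Matrix (Fin n) (Fin n) F) : graphVector p Γ ≠ 0 := fun h =>
  omegaPow_ne_zero p _ (congrFun h 0)

/-- Testing on vectors supported at one coordinate reduces this to nondegeneracy of the trace form
of a separable extension. -/
theorem eq_zero_of_trace_dotProduct [Finite F] {b : Fin n → F}
    (h : ∀ z : Fin n → F, Algebra.trace (ZMod p) F (b ⬝ᵥ z) = 0) : b = 0 := by
  funext i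
  have : Algebra.IsSeparable (ZMod p) F := inferInstance
  refine (traceForm_nondegenerate (ZMod p) F).1 (b i) fun x => ?_
  rw [Algebra.traceForm_apply]
  simpa using h (Pi.single i x)

end Trace

end GraphPhase

section WeightMatrix

variable {F : Type*} [Field F] {n : ℕ} (G : SimpleGraph (Fin n)) [DecidableRel G.Adj]
  (w : Sym2 (Fin n) → F)

/-- The weighted adjacency matrix. -/
def weightMatrix : Matrix (Fin n) (Fin n) F :=
  Matrix.of fun u v => if G.Adj u v then w s(u, v) else 0

theorem weightMatrix_isSymm : (weightMatrix G w).IsSymm := by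
  ext u v
  simp [weightMatrix, G.adj_comm, Sym2.eq_swap]

theorem weightMatrix_diag (i : Fin n) : weightMatrix G w i i = 0 := by simp [weightMatrix]

end WeightMatrix

/-! ### The graph state and its stabilizer. -/

section GraphState

variable (p : ℕ) [Fact p.Prime] {F : Type*} [Field F] [Fintype F] [DecidableEq F]
  [Algebra (ZMod p) F] {n : ℕ}

theorem pauliOp_mulVec (c : ZMod p) (a b : Fin n → F) (ψ : (Fin n → F) → ℂ) (y : Fin n → F) :
    (pauliOp p c a b *ᵥ ψ) y =
      omegaPow p (c + Algebra.trace (ZMod p) F (b ⬝ᵥ (y - a))) * ψ (y - a) := by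
  rw [Matrix.mulVec, dotProduct, Finset.sum_eq_single (y - a)]
  · simp [pauliOp, tensorOp, opXZ_apply, omegaPow_add, dotProduct, omegaPow_sum]
  · intro x _ hx
    obtain ⟨i, hi⟩ := Function.ne_iff.mp hx
    have h : ∏ i, (opX (a i) * opZ p (b i)) (y i) (x i) = 0 :=
      Finset.prod_eq_zero (Finset.mem_univ i) (by
        rw [opXZ_apply, if_neg]
        intro h
        exact hi (by simp [h]))
    simp [pauliOp, tensorOp, h]
  · simp

/-- The element of the stabilizer group of a weighted graph with `X`-part `a`. -/
noncomputable def graphElement (Γ : Matrix (Fin n) (Fin n) F) (a : Fin n → F) :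
    (Matrix (Fin n → F) (Fin n → F) ℂ)ˣ :=
  pauli p (graphPhase p Γ a) a (Γ *ᵥ a)

/-- The phase `tr (Γa · a')` arising when `Z(Γa)` passes `X(a')` is exactly the polarization of
`graphPhase`. -/
theorem graphElement_add {Γ : Matrix (Fin n) (Fin n) F} (hΓ : Γ.IsSymm) (hd : ∀ i, Γ i i = 0)
    (a a' : Fin n → F) :
    graphElement p Γ (a + a') = graphElement p Γ a * graphElement p Γ a' := by
  refine Units.ext ?_
  rw [Units.val_mul]
  simp only [graphElement, pauli]
  rw [pauliOp_mul, graphPhase_add p hΓ hd, Matrix.mulVec_add, dotProduct, map_sum]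

theorem graphElement_zero (Γ : Matrix (Fin n) (Fin n) F) : graphElement p Γ 0 = 1 := by
  refine Units.ext ?_
  simp only [graphElement, pauli, graphPhase_zero, Matrix.mulVec_zero, pauliOp_zero, Units.val_one]

theorem pauli_fixes_graphVector_iff {Γ : Matrix (Fin n) (Fin n) F} (hΓ : Γ.IsSymm)
    (hd : ∀ i, Γ i i = 0) (c : ZMod p) (a b : Fin n → F) :
    (pauli p c a b).val *ᵥ graphVector p Γ = graphVector p Γ ↔
      c = graphPhase p Γ a ∧ b = Γ *ᵥ a := by
  have key : (pauli p c a b).val *ᵥ graphVector p Γ = graphVector p Γ ↔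
      ∀ z : Fin n → F, c + Algebra.trace (ZMod p) F (b ⬝ᵥ z) =
        graphPhase p Γ a + Algebra.trace (ZMod p) F (Γ *ᵥ a ⬝ᵥ z) := by
    -- Comparing amplitudes at `a + z` makes `graphPhase p Γ z` cancel; an identity between an
    -- affine function of `z` and another remains.
    rw [funext_iff, ← (Equiv.addLeft a).forall_congr_right]
    refine forall_congr' fun z => ?_
    simp only [pauli, pauliOp_mulVec, graphVector, Equiv.coe_addLeft, add_sub_cancel_left]
    rw [← omegaPow_add, (omegaPow_injective p).eq_iff, graphPhase_add p hΓ hd,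
      add_right_comm (graphPhase p Γ a), add_left_inj]
  rw [key]
  constructor
  · intro h
    have hc : c = graphPhase p Γ a := by simpa using h 0
    refine ⟨hc, sub_eq_zero.mp (eq_zero_of_trace_dotProduct p fun z => ?_)⟩
    have hz := h z
    rw [hc, add_right_inj] at hz
    rw [sub_dotProduct, map_sub, hz, sub_self]
  · rintro ⟨rfl, rfl⟩ z
    rfl

/-- The operator with `X`-part `a` carries the amplitude at `0` to the amplitude at `a`. -/
theorem eq_smul_graphVector (Γ : Matrix (Fin n) (Fin n) F)
    {ψ : (Fin n → F) → ℂ} (h : ∀ a, (graphElement p Γ a).val *ᵥ ψ = ψ) :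
    ψ = ψ 0 • graphVector p Γ := by
  funext a
  rw [← congrFun (h a) a]
  simp only [graphElement, pauli, pauliOp_mulVec, sub_self, dotProduct_zero, map_zero, add_zero,
    Pi.smul_apply, smul_eq_mul, graphVector]
  rw [mul_comm]

section Weighted

variable (G : SimpleGraph (Fin n)) [DecidableRel G.Adj] (w : Sym2 (Fin n) → F)

theorem graphGenerator_eq (v : Fin n) (a : F) :
    graphGenerator p G w v a = graphElement p (weightMatrix G w) (Pi.single v a) := by
  rw [graphGenerator, graphElement, graphPhase_single]
  congr 1
  funext u
  simp [weightMatrix, G.adj_comm, Sym2.eq_swap, mul_comm]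

theorem mem_graphStabilizer_iff {g : (Matrix (Fin n → F) (Fin n → F) ℂ)ˣ} :
    g ∈ graphStabilizer p G w ↔ ∃ a, g = graphElement p (weightMatrix G w) a := by
  have hadd := graphElement_add p (weightMatrix_isSymm G w) (weightMatrix_diag G w)
  constructor
  · intro hg
    induction hg using Subgroup.closure_induction with
    | mem x hx =>
      obtain ⟨v, a, rfl⟩ := hx
      exact ⟨_, graphGenerator_eq p G w v a⟩
    | one => exact ⟨0, (graphElement_zero p _).symm⟩
    | mul x y _ _ hx hy =>
      obtain ⟨a, rfl⟩ := hx
      obtain ⟨b, rfl⟩ := hy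
      exact ⟨a + b, (hadd a b).symm⟩
    | inv x _ hx =>
      obtain ⟨a, rfl⟩ := hx
      refine ⟨-a, inv_eq_of_mul_eq_one_right ?_⟩
      rw [← hadd, add_neg_cancel, graphElement_zero]
  · rintro ⟨a, rfl⟩
    -- Additivity turns the decomposition of `a` into its coordinates into a product of generators.
    have h : ∀ s : Finset (Fin n),
        graphElement p (weightMatrix G w) (∑ v ∈ s, Pi.single v (a v)) ∈
          graphStabilizer p G w := by
      intro s
      induction s using Finset.induction_on with
      | empty => simp [graphElement_zero, one_mem]
      | insert v s hv ih =>
        rw [Finset.sum_insert hv, hadd]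
        exact mul_mem (Subgroup.subset_closure ⟨v, a v, (graphGenerator_eq p G w v _).symm⟩) ih
    simpa [Finset.univ_sum_single] using h Finset.univ

theorem graphState_eq_span :
    graphState p G w = Submodule.span ℂ {graphVector p (weightMatrix G w)} := by
  ext ψ
  rw [Submodule.mem_span_singleton]
  constructor
  · intro h
    exact ⟨ψ 0, (eq_smul_graphVector p _ fun a =>
      h _ ((mem_graphStabilizer_iff p G w).mpr ⟨a, rfl⟩)).symm⟩
  · rintro ⟨z, rfl⟩
    refine Submodule.smul_mem _ z fun g hg => ?_
    obtain ⟨a, rfl⟩ := (mem_graphStabilizer_iff p G w).mp hg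
    exact (pauli_fixes_graphVector_iff p (weightMatrix_isSymm G w) (weightMatrix_diag G w)
      _ _ _).mpr ⟨rfl, rfl⟩

theorem graphVector_mem : graphVector p (weightMatrix G w) ∈ graphState p G w := by
  rw [graphState_eq_span]
  exact Submodule.mem_span_singleton_self _

theorem pauli_mem_codeStabilizer_iff (c : ZMod p) (a b : Fin n → F) :
    pauli p c a b ∈ codeStabilizer p (graphState p G w) ↔
      c = graphPhase p (weightMatrix G w) a ∧ b = weightMatrix G w *ᵥ a := by
  rw [← pauli_fixes_graphVector_iff p (weightMatrix_isSymm G w) (weightMatrix_diag G w)]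
  constructor
  · exact fun h => h.2 _ (graphVector_mem p G w)
  · intro h
    refine ⟨⟨c, a, b, rfl⟩, fun ψ hψ => ?_⟩
    rw [graphState_eq_span, Submodule.mem_span_singleton] at hψ
    obtain ⟨z, rfl⟩ := hψ
    rw [Matrix.mulVec_smul, h]

theorem codeStabilizer_graphState :
    codeStabilizer p (graphState p G w) = graphStabilizer p G w := by
  ext g
  rw [mem_graphStabilizer_iff]
  constructor
  · intro hg
    obtain ⟨c, a, b, rfl⟩ := hg.1
    obtain ⟨rfl, rfl⟩ := (pauli_mem_codeStabilizer_iff p G w c a b).mp hg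
    exact ⟨a, rfl⟩
  · rintro ⟨a, rfl⟩
    exact (pauli_mem_codeStabilizer_iff p G w _ _ _).mpr ⟨rfl, rfl⟩

end Weighted

end GraphState

/-! ### The Lagrangian subspace `{(a | Γa)}` and the conclusion. -/

section GraphSubspace

variable {F : Type*} [Field F] {n : ℕ}

/-- The linear map `a ↦ (a | Γ a)`. -/
def graphEmbedding (Γ : Matrix (Fin n) (Fin n) F) : (Fin n → F) →ₗ[F] (J n → F) where
  toFun a := Sum.elim a (Γ *ᵥ a)
  map_add' a b := by
    ext (i | i) <;> simp [Matrix.mulVec_add]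
  map_smul' c a := by
    ext (i | i) <;> simp [Matrix.mulVec_smul]

theorem finrank_range_graphEmbedding (Γ : Matrix (Fin n) (Fin n) F) :
    Module.finrank F (LinearMap.range (graphEmbedding Γ)) = n := by
  rw [LinearMap.finrank_range_of_inj, Module.finrank_fin_fun]
  intro a b h
  exact funext fun i => congrFun h (Sum.inl i)

theorem isIsotropic_range_graphEmbedding {Γ : Matrix (Fin n) (Fin n) F} (hΓ : Γ.IsSymm) :
    IsIsotropic (LinearMap.range (graphEmbedding Γ)) := by
  rintro _ ⟨a, rfl⟩ _ ⟨b, rfl⟩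
  change a ⬝ᵥ Γ *ᵥ b - b ⬝ᵥ Γ *ᵥ a = 0
  rw [Matrix.dotProduct_mulVec, ← Matrix.mulVec_transpose, hΓ.eq, dotProduct_comm, sub_self]

end GraphSubspace

theorem symplecticImage_graphState (p : ℕ) [Fact p.Prime] {F : Type*} [Field F] [Fintype F]
    [DecidableEq F] [Algebra (ZMod p) F] {n : ℕ} (G : SimpleGraph (Fin n)) [DecidableRel G.Adj]
    (w : Sym2 (Fin n) → F) :
    symplecticImage p (codeStabilizer p (graphState p G w)) =
      (LinearMap.range (graphEmbedding (weightMatrix G w)) : Set (J n → F)) := by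
  ext u
  constructor
  · rintro ⟨c, a, b, h, rfl⟩
    obtain ⟨-, rfl⟩ := (pauli_mem_codeStabilizer_iff p G w c a b).mp h
    exact ⟨a, rfl⟩
  · rintro ⟨a, rfl⟩
    exact ⟨_, a, _, (pauli_mem_codeStabilizer_iff p G w _ _ _).mpr ⟨rfl, rfl⟩, rfl⟩

theorem isLinearStabilizerCode_graphState (p : ℕ) [Fact p.Prime] {F : Type*} [Field F] [Fintype F]
    [DecidableEq F] [Algebra (ZMod p) F] {n : ℕ} (G : SimpleGraph (Fin n)) [DecidableRel G.Adj]
    (w : Sym2 (Fin n) → F) : IsLinearStabilizerCode p 0 (graphState p G w) where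
  dim := by
    rw [graphState_eq_span, finrank_span_singleton (graphVector_ne_zero p _), pow_zero]
  eigenspace := by rw [codeStabilizer_graphState, graphState]
  abelian := by
    have hadd := graphElement_add p (weightMatrix_isSymm G w) (weightMatrix_diag G w)
    intro g hg h hh
    rw [codeStabilizer_graphState, mem_graphStabilizer_iff] at hg hh
    obtain ⟨a, rfl⟩ := hg
    obtain ⟨b, rfl⟩ := hh
    rw [← hadd, ← hadd, add_comm]
  scalar := by
    intro g hg z hz
    have h := hg.2 _ (graphVector_mem p G w)
    rw [hz, Matrix.smul_mulVec, Matrix.one_mulVec] at h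
    have hz1 : z = 1 := by
      rw [← sub_eq_zero, ← smul_eq_zero_iff_left (graphVector_ne_zero p (weightMatrix G w)),
        sub_smul, h, one_smul, sub_self]
    refine Units.ext ?_
    rw [hz, hz1, one_smul, Units.val_one]
  linear := ⟨_, (symplecticImage_graphState p G w).symm⟩

end QuantumMatroid

theorem mainTheorem7 (p : ℕ) [Fact p.Prime] {F : Type*} [Field F] [Fintype F] [DecidableEq F]
    [Algebra (ZMod p) F] (n : ℕ) (G : SimpleGraph (Fin n)) [DecidableRel G.Adj]
    (w : Sym2 (Fin n) → F) :
    QuantumMatroid.IsLinearStabilizerCode p 0 (QuantumMatroid.graphState p G w) ∧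
    QuantumMatroid.codeStabilizer p (QuantumMatroid.graphState p G w) =
      QuantumMatroid.graphStabilizer p G w ∧
    ∃ L : QuantumMatroid.SymplecticMatroid n,
      QuantumMatroid.Induces p (QuantumMatroid.graphState p G w) L ∧
      L.IsRepresentable F ∧ L.IsLagrangian := by
  have hU := QuantumMatroid.isIsotropic_range_graphEmbedding
    (QuantumMatroid.weightMatrix_isSymm G w)
  have hS := QuantumMatroid.symplecticImage_graphState p G w
  obtain ⟨M, hM, hMU⟩ := QuantumMatroid.exists_matrix_rowSpace_eq
    (LinearMap.range (QuantumMatroid.graphEmbedding (QuantumMatroid.weightMatrix G w)))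
  refine ⟨QuantumMatroid.isLinearStabilizerCode_graphState p G w,
    QuantumMatroid.codeStabilizer_graphState p G w, QuantumMatroid.isotropicMatroid _ hU,
    ⟨⟨_, M, hM, by rw [hMU, hS]⟩, fun r N hN => ?_⟩,
    ⟨_, M, QuantumMatroid.isotropicMatroid_isRepresentedBy hU hM hMU⟩,
    QuantumMatroid.finrank_range_graphEmbedding _⟩
  -- All stabilizer matrices share one row space, and the matroid depends on nothing else.
  exact QuantumMatroid.isotropicMatroid_isRepresentedBy hU hN.1
    (SetLike.coe_injective (hN.2.trans hS))
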